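/- Let $d>1$ be an integer and let $S_{\mathbb{Q},d}=\{K\subset\overline{\mathbb{Q}} : [K:\mathbb{Q}]=d\}$ be the collection of all number fields of degree $d$ inside a fixed algebraic closure $\overline{\mathbb{Q}}$ of $\mathbb{Q}$. For a number field $K$ let $D_K$ be the modulus of its discriminant and let $Cl_K[\ell]=\{c\in Cl_K : c^\ell=1\}$ be the $\ell$-torsion subgroup of its class group. For $\alpha\in K$ let $H_K(\alpha)=\prod_{v}\max\{1,|\alpha|_v\}^{d_v}$ be the relative multiplicative Weil height, where $v$ runs over the places of $K$, $|\cdot|_v$ extends one of the usual absolute values of $\mathbb{Q}$, and $d_v=[K_v:\mathbb{Q}_v]$. For $S\subset S_{\mathbb{Q},d}$ put $$P_S=\{\alpha\in\overline{\mathbb{Q}} : \mathbb{Q}(\alpha)\in S\},\qquad N_H(P_S,X)=\#\{\alpha\in P_S : H_{\mathbb{Q}(\alpha)}(\alpha)\le X\},$$ $$\mathscr{B}_S(X;Y,M)=\{K\in S : D_K\le X,\ \text{at most } M \text{ primes } p\le Y \text{ split completely in } K\}.$$ Throughout $X\ge 2$ is real, and the implied constants depend only on the indicated parameters. **Proposition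 3.1.** Suppose $S\subset S_{\mathbb{Q},d}$ and $\theta>0$ are such that $N_H(P_S,X)\ll_{S,\theta}X^\theta$ for all $X\ge 2$. Let $\ell\ge 1$ be an integer, let $\gamma>0$, $\varepsilon>0$, $\tilde\delta_0>0$, put $\delta_0=\min\{\gamma/\ell-2\varepsilon,\tilde\delta_0\}$, and let $E_{\delta_0,\varepsilon}(\cdot)$ be a (weakly) increasing real-valued function on $[2,\infty)$ such that $$\#\mathscr{B}_S(X;X^{\delta_0},X^{\delta_0-\varepsilon})\le E_{\delta_0,\varepsilon}(X)\qquad\text{for all } X\ge 2.$$ Then for every $X\ge 2$ the bound $$\#Cl_K[\ell]\ll_{d,\ell,\gamma,\varepsilon}D_K^{1/2-\delta_0+2\varepsilon}$$ holds for all but $O_{S,\theta}\big((\log X)\,E_{\delta_0,\varepsilon}(X)+X^{\gamma\theta}\big)$ fields $K$ in $S$ with $D_K\le X$. -/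

import Mathlib

namespace ClassGroupTorsion

open NumberField IntermediateField

noncomputable section

/-- The number fields inside a fixed algebraic closure of `ℚ`. -/
abbrev NField : Type :=
  {K : IntermediateField ℚ (AlgebraicClosure ℚ) // FiniteDimensional ℚ K}

instance instFiniteDimensionalNField (K : NField) : FiniteDimensional ℚ K.1 := K.2

instance instNumberFieldNField (K : NField) : NumberField K.1 := { }

instance instIsAlgebraicRat : Algebra.IsAlgebraic ℚ (AlgebraicClosure ℚ) := by
  have h : (DivisionRing.toRatAlgebra : Algebra ℚ (AlgebraicClosure ℚ)) =
      AlgebraicClosure.instAlgebra ℚ := Subsingleton.elim _ _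
  rw [h]
  exact AlgebraicClosure.isAlgebraic ℚ

instance instFiniteDimensionalAdjoin (α : AlgebraicClosure ℚ) : FiniteDimensional ℚ ℚ⟮α⟯ :=
  adjoin.finiteDimensional (Algebra.IsIntegral.isIntegral α)

/-- The number field `ℚ(α)` generated by an algebraic number `α`. -/
def adjoinField (α : AlgebraicClosure ℚ) : NField := ⟨ℚ⟮α⟯, instFiniteDimensionalAdjoin α⟩

/-- The collection of all number fields of degree `d`. -/
def fieldsOfDegree (d : ℕ) : Set NField := {K | Module.finrank ℚ K.1 = d}

/-- `D_K`, the modulus of the discriminant of `K`. -/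
def absDiscr (K : NField) : ℕ := (discr K.1).natAbs

/-- `#Cl_K[ℓ]`, the number of ideal classes `c` of `K` with `c ^ ℓ = 1`. -/
def clTorsion (K : NField) (ℓ : ℕ) : ℕ := Nat.card {c : ClassGroup (𝓞 K.1) // c ^ ℓ = 1}

/-- `H_{ℚ(α)}(α)`, the multiplicative Weil height of `α` relative to the field `ℚ(α)`: the product
of `max 1 |α|_v ^ d_v` over all places `v` of `ℚ(α)`, with `d_v` the local degree. Mathlib's finite
places are normalized by the ideal norm, so that they already include the exponent `d_v`. -/
def relHeight (α : AlgebraicClosure ℚ) : ℝ :=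
  Height.mulHeight₁ (K := (adjoinField α).1) (AdjoinSimple.gen ℚ α)

/-- `P_S`, the set of algebraic numbers which generate a field in `S`. -/
def generators (S : Set NField) : Set (AlgebraicClosure ℚ) := {α | adjoinField α ∈ S}

/-- The set of elements of `P_S` of relative height at most `X`; its cardinality is `N_H(P_S, X)`. -/
def generatorsOfHeightLE (S : Set NField) (X : ℝ) : Set (AlgebraicClosure ℚ) :=
  {α | α ∈ generators S ∧ relHeight α ≤ X}

/-- The rational prime `p` splits completely in `K`: every prime ideal of `𝓞 K` above `p` has
ramification index and residue degree one. -/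
def SplitsCompletely (p : ℕ) (K : NField) : Prop :=
  ∀ P ∈ (Ideal.span {(p : ℤ)}).primesOver (𝓞 K.1),
    P.ramificationIdx ℤ = 1 ∧ P.inertiaDeg ℤ = 1

/-- The set of primes `p ≤ Y` which split completely in `K` (a finite set). -/
def splitPrimes (K : NField) (Y : ℝ) : Set ℕ :=
  {p | p.Prime ∧ (p : ℝ) ≤ Y ∧ SplitsCompletely p K}

/-- `ℬ_S(X; Y, M)`, the set of `K ∈ S` with `D_K ≤ X` such that at most `M` primes `p ≤ Y` split
completely in `K`. -/
def badFields (S : Set NField) (X Y M : ℝ) : Set NField :=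
  {K | K ∈ S ∧ (absDiscr K : ℝ) ≤ X ∧ ((splitPrimes K Y).ncard : ℝ) ≤ M}

/-- The set `A` is finite and has at most `r` elements. -/
def CardLE {T : Type*} (A : Set T) (r : ℝ) : Prop := A.Finite ∧ (A.ncard : ℝ) ≤ r

end

end ClassGroupTorsion

/-!
Fix `K` of degree `n` and discriminant `D = D_K`, and suppose that many primes `p ≤ Y` split
completely in `K`; choose a prime `P` of `K` above each of them. The argument of Ellenberg and
Venkatesh is a pigeonhole principle in the Arakelov class group, whose points are ideals together
with a positive weight at each infinite place. Every class in `Cl_K[ℓ]` lifts to an `ℓ`-torsion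
point (`exists_torsion_representative`). By Minkowski's theorem (`exists_mem_ideal_lt`) every point
of degree zero reduces to an integral ideal of norm `O(√D)` with weights in a box of side
`O(log D)` (`exists_reduction`). There are `O(D ^ (1/2 + ε))` such ideals
(`ncard_ideals_absNorm_le`), and boundedly many cubes of side `(ε / n) log D` cover the box. If
`#Cl_K[ℓ]` times the number of the `P` is larger than this, two translates of torsion points by
distinct `P` and `Q` reduce to the same ideal and the same cube; taking `ℓ`-th powers gets rid of
the torsion, and `(P / Q) ^ ℓ` is generated by an element whose absolute values are, up to a factor
`D ^ (ε ℓ / n)`, the ones that the product formula suggests (`card_torsion_mul_card_le`). Regulators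
and zeta functions are not needed, because the box of weights is covered directly.

Such an element has height at most `(D ^ ε Y) ^ ℓ` (`mulHeight₁_div_le`), and it generates `K`,
since, after multiplication by a power of the other rational prime, it lies in exactly one of the
primes above the completely split `p`, whereas every prime of a proper subfield above `p` has
several primes of `K` above it (`adjoin_div_eq_top`). With `Y` about `D ^ δ₀` and
`δ₀ ≤ γ / ℓ - 2 ε` the height is at most `D ^ γ`.

Hence the bound for `#Cl_K[ℓ]` holds unless `K` has a generator of height at most `X ^ γ`, which
happens for `O(X ^ (γ θ))` fields, or `K` has few split primes. The latter fields are counted at the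
`O(log X)` dyadic scales `Z = X / 2 ^ k` with `D ≤ Z < 2 D`. The change from `D` to `Z` costs a
factor `2 ^ γ` in the height, which is harmless once `D` is large in terms of `γ` and `ε`; the
remaining fields are finite in number by Hermite's theorem and only affect the constant
(`exists_clTorsion_le_rpow`).
-/

namespace ClassGroupTorsion

open NumberField Module nonZeroDivisors IntermediateField UniqueFactorizationMonoid

/-! ### Primes above a rational prime -/

section RationalPrimes

variable {K : Type*} [Field K]

theorem isPrime_span_natCast {p : ℕ} (hp : p.Prime) : (Ideal.span {(p : ℤ)}).IsPrime :=
  (Ideal.span_singleton_prime (by exact_mod_cast hp.ne_zero)).2 (Nat.prime_iff_prime_int.1 hp)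

theorem isMaximal_span_natCast {p : ℕ} (hp : p.Prime) : (Ideal.span {(p : ℤ)}).IsMaximal :=
  (isPrime_span_natCast hp).isMaximal (by simpa using hp.ne_zero)

theorem isMaximal_of_mem_primesOver {p : ℕ} (hp : p.Prime) {P : Ideal (𝓞 K)}
    (hP : P ∈ (Ideal.span {(p : ℤ)}).primesOver (𝓞 K)) : P.IsMaximal := by
  have := isMaximal_span_natCast hp
  have := hP.1
  have := hP.2
  exact Ideal.IsMaximal.of_liesOver_isMaximal P (Ideal.span {(p : ℤ)})

theorem natCast_mem_of_mem_primesOver {p : ℕ} {P : Ideal (𝓞 K)}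
    (hP : P ∈ (Ideal.span {(p : ℤ)}).primesOver (𝓞 K)) : (p : 𝓞 K) ∈ P := by
  have h : (p : ℤ) ∈ P.under ℤ := by
    rw [← hP.2.over]
    exact Ideal.mem_span_singleton_self _
  simpa [Ideal.mem_comap] using h

end RationalPrimes

/-! ### Counting ideals of bounded norm -/

section IdealCount

variable (K : Type*) [Field K] [NumberField K]

theorem ncard_primesOver_le_finrank {p : ℕ} (hp : p.Prime) :
    ((Ideal.span {(p : ℤ)}).primesOver (𝓞 K)).ncard ≤ finrank ℚ K := by
  have := isPrime_span_natCast hp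
  have hfin : ((Ideal.span {(p : ℤ)}).primesOver (𝓞 K)).Finite :=
    Algebra.QuasiFinite.finite_primesOver _
  let := hfin.fintype
  rw [← RingOfIntegers.rank,
    ← Ideal.sum_ramification_inertia_eq_finrank (Ideal.span {(p : ℤ)}) (𝓞 K),
    Set.ncard_eq_toFinset_card', Set.toFinset_card, ← Finset.card_univ, Finset.card_eq_sum_ones]
  refine Finset.sum_le_sum fun P _ => ?_
  have := P.2.1
  exact Nat.mul_pos (Ideal.ramificationIdx_pos _ _) (Ideal.inertiaDeg_pos _ _)

variable {K} in
/-- The residue characteristic of a maximal ideal is the least prime factor of its norm. -/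
theorem exists_absNorm_eq_minFac_pow (P : Ideal (𝓞 K)) (hP : P.IsMaximal) :
    ∃ n, 0 < n ∧ (Ideal.absNorm P).minFac.Prime ∧
      P ∈ (Ideal.span {((Ideal.absNorm P).minFac : ℤ)}).primesOver (𝓞 K) ∧
      Ideal.absNorm P = (Ideal.absNorm P).minFac ^ n := by
  obtain ⟨p, n, hn, hpP, hp, h⟩ := Ideal.exists_prime_and_absNorm_eq_pow P
  have hm : (Ideal.absNorm P).minFac = p := by
    rw [h, hp.pow_minFac hn.ne']
  rw [hm]
  refine ⟨n, hn, hp, ⟨hP.isPrime, ⟨?_⟩⟩, h⟩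
  refine (isMaximal_span_natCast hp).eq_of_le (Ideal.comap_ne_top _ hP.ne_top) ?_
  rw [Ideal.span_singleton_le_iff_mem]
  simpa [Ideal.mem_comap] using hpP

/-- The primes of `K` can be labelled by `Fin [K : ℚ]` so that distinct primes of the same residue
characteristic have distinct labels, since at most `[K : ℚ]` primes lie above a rational prime. -/
theorem exists_label : ∃ idx : Ideal (𝓞 K) → Fin (finrank ℚ K), ∀ P Q : Ideal (𝓞 K),
    P.IsMaximal → Q.IsMaximal → (Ideal.absNorm P).minFac = (Ideal.absNorm Q).minFac →
    idx P = idx Q → P = Q := by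
  have key : ∀ p : ℕ, ∃ f : Ideal (𝓞 K) → Fin (finrank ℚ K), p.Prime →
      Set.InjOn f ((Ideal.span {(p : ℤ)}).primesOver (𝓞 K)) := by
    intro p
    have : Nonempty (Fin (finrank ℚ K)) := ⟨⟨0, finrank_pos⟩⟩
    by_cases hp : p.Prime
    · have hfin : ((Ideal.span {(p : ℤ)}).primesOver (𝓞 K)).Finite := by
        have := isPrime_span_natCast hp
        exact Algebra.QuasiFinite.finite_primesOver _
      obtain ⟨f, -, hf⟩ := Set.Finite.exists_injOn_of_encard_le
        (t := (Set.univ : Set (Fin (finrank ℚ K)))) hfin (by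
        rw [← hfin.cast_ncard_eq, Set.encard_univ]
        simpa using ncard_primesOver_le_finrank K hp)
      exact ⟨f, fun _ => hf⟩
    · exact ⟨fun _ => Classical.arbitrary _, fun h => absurd h hp⟩
  choose f hf using key
  refine ⟨fun P => f (Ideal.absNorm P).minFac P, fun P Q hP hQ h hidx => ?_⟩
  obtain ⟨-, -, hp, hP', -⟩ := exists_absNorm_eq_minFac_pow P hP
  obtain ⟨-, -, -, hQ', -⟩ := exists_absNorm_eq_minFac_pow Q hQ
  rw [← h] at hQ'
  simp only [← h] at hidx
  exact hf _ hp hP' hQ' hidx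

variable {K}

/-- The norm of the part of the ideal with prime factors `s` supported on primes of label `k`. -/
noncomputable def labelledNorm (idx : Ideal (𝓞 K) → Fin (finrank ℚ K)) (s : Multiset (Ideal (𝓞 K)))
    (k : Fin (finrank ℚ K)) : ℕ :=
  ((s.filter (idx · = k)).map Ideal.absNorm).prod

theorem prod_labelledNorm (idx : Ideal (𝓞 K) → Fin (finrank ℚ K)) (s : Multiset (Ideal (𝓞 K))) :
    ∏ k, labelledNorm idx s k = Ideal.absNorm s.prod := by
  induction s using Multiset.induction_on with
  | empty => simp [labelledNorm]
  | cons P s ih =>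
    have : ∀ k, labelledNorm idx (P ::ₘ s) k =
        (if idx P = k then Ideal.absNorm P else 1) * labelledNorm idx s k := by
      intro k
      by_cases h : idx P = k <;> simp [labelledNorm, h]
    rw [Finset.prod_congr rfl fun k _ => this k, Finset.prod_mul_distrib, ih]
    simp

theorem factorization_labelledNorm {idx : Ideal (𝓞 K) → Fin (finrank ℚ K)}
    (hidx : ∀ P Q : Ideal (𝓞 K), P.IsMaximal → Q.IsMaximal →
      (Ideal.absNorm P).minFac = (Ideal.absNorm Q).minFac → idx P = idx Q → P = Q)
    {P : Ideal (𝓞 K)} (hP : P.IsMaximal) {s : Multiset (Ideal (𝓞 K))} (hs : ∀ Q ∈ s, Q.IsMaximal)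
    {n : ℕ} (hn : Ideal.absNorm P = (Ideal.absNorm P).minFac ^ n) [DecidableEq (Ideal (𝓞 K))] :
    labelledNorm idx s (idx P) ≠ 0 ∧
    (labelledNorm idx s (idx P)).factorization (Ideal.absNorm P).minFac = s.count P * n := by
  obtain ⟨-, -, hp, -, -⟩ := exists_absNorm_eq_minFac_pow P hP
  induction s using Multiset.induction_on with
  | empty => simp [labelledNorm]
  | cons Q s ih =>
    obtain ⟨ih0, ih⟩ := ih fun R hR => hs R (Multiset.mem_cons_of_mem hR)
    have hQ := hs Q (Multiset.mem_cons_self _ _)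
    obtain ⟨m, hm, hq, -, hQm⟩ := exists_absNorm_eq_minFac_pow Q hQ
    have hQ0 : Ideal.absNorm Q ≠ 0 := by rw [hQm]; exact pow_ne_zero _ hq.ne_zero
    by_cases h : idx Q = idx P
    · have e : labelledNorm idx (Q ::ₘ s) (idx P) =
          Ideal.absNorm Q * labelledNorm idx s (idx P) := by
        simp [labelledNorm, h]
      rw [e]
      refine ⟨mul_ne_zero hQ0 ih0, ?_⟩
      rw [Nat.factorization_mul hQ0 ih0, Finsupp.add_apply, ih]
      by_cases hQP : Q = P
      · subst hQP
        rw [Multiset.count_cons_self]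
        have : (Ideal.absNorm Q).factorization (Ideal.absNorm Q).minFac = n := by
          calc _ = ((Ideal.absNorm Q).minFac ^ n).factorization (Ideal.absNorm Q).minFac := by
                rw [← hn]
            _ = n := by rw [hp.factorization_pow, Finsupp.single_eq_same]
        rw [this]; ring
      · rw [Multiset.count_cons_of_ne (Ne.symm hQP)]
        have : (Ideal.absNorm Q).factorization (Ideal.absNorm P).minFac = 0 := by
          rw [hQm, hq.factorization_pow, Finsupp.single_eq_of_ne]
          intro h'
          exact hQP (hidx Q P hQ hP (by rw [← h']) h)
        rw [this, zero_add]
    · have e : labelledNorm idx (Q ::ₘ s) (idx P) = labelledNorm idx s (idx P) := by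
        simp [labelledNorm, h]
      rw [e, ih, Multiset.count_cons_of_ne (by rintro rfl; exact h rfl)]
      exact ⟨ih0, rfl⟩

theorem isMaximal_of_mem_normalizedFactors {I Q : Ideal (𝓞 K)} (hQ : Q ∈ normalizedFactors I) :
    Q.IsMaximal := by
  have := prime_of_normalized_factor Q hQ
  exact (Ideal.isPrime_of_prime this).isMaximal this.ne_zero

/-- An ideal is determined by the tuple of its labelled norms: for each rational prime `p` and each
label there is at most one prime above `p`, and its exponent is read off from the power of `p`. -/
theorem labelledNorm_injOn {idx : Ideal (𝓞 K) → Fin (finrank ℚ K)}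
    (hidx : ∀ P Q : Ideal (𝓞 K), P.IsMaximal → Q.IsMaximal →
      (Ideal.absNorm P).minFac = (Ideal.absNorm Q).minFac → idx P = idx Q → P = Q) :
    Set.InjOn (fun I : Ideal (𝓞 K) => labelledNorm idx (normalizedFactors I)) {I | I ≠ ⊥} := by
  classical
  intro I hI J hJ h
  have hI' : I ≠ 0 := hI
  have hJ' : J ≠ 0 := hJ
  rw [← associated_iff_eq, associated_iff_normalizedFactors_eq_normalizedFactors hI' hJ']
  ext P
  by_cases hP : P.IsMaximal
  · obtain ⟨n, hn, hp, -, hPn⟩ := exists_absNorm_eq_minFac_pow P hP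
    have h1 := (factorization_labelledNorm hidx hP
      (s := normalizedFactors I) (fun _ => isMaximal_of_mem_normalizedFactors) hPn).2
    have h2 := (factorization_labelledNorm hidx hP
      (s := normalizedFactors J) (fun _ => isMaximal_of_mem_normalizedFactors) hPn).2
    have h' := congr_fun h (idx P)
    simp only at h'
    rw [h', h2] at h1
    exact (Nat.eq_of_mul_eq_mul_right hn h1).symm
  · rw [Multiset.count_eq_zero_of_notMem fun h => hP (isMaximal_of_mem_normalizedFactors h),
      Multiset.count_eq_zero_of_notMem fun h => hP (isMaximal_of_mem_normalizedFactors h)]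

variable (K) in
theorem finite_ideals_absNorm_le (x : ℝ) :
    {I : Ideal (𝓞 K) | I ≠ ⊥ ∧ (Ideal.absNorm I : ℝ) ≤ x}.Finite :=
  (Ideal.finite_setOfPred_absNorm_le (S := 𝓞 K) ⌊x⌋₊).subset fun _ hI => Nat.le_floor hI.2

variable (K) in
/-- For `s > 1`, the number of nonzero ideals of norm at most `x` is at most `ζ(s) ^ n * x ^ s`: by
`labelledNorm_injOn` there are no more of them than `n`-tuples of positive integers of product at
most `x`. -/
theorem ncard_ideals_absNorm_le {s : ℝ} (hs : 1 < s) {x : ℝ} (hx : 0 ≤ x) :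
    ({I : Ideal (𝓞 K) | I ≠ ⊥ ∧ (Ideal.absNorm I : ℝ) ≤ x}.ncard : ℝ) ≤
      (∑' m : ℕ, (m : ℝ) ^ (-s)) ^ finrank ℚ K * x ^ s := by
  classical
  obtain ⟨idx, hidx⟩ := exists_label K
  have hfin := finite_ideals_absNorm_le K x
  set A := hfin.toFinset
  have hA : ∀ I ∈ A, I ≠ ⊥ ∧ (Ideal.absNorm I : ℝ) ≤ x := fun I hI => by simpa [A] using hI
  let F : Ideal (𝓞 K) → (Fin (finrank ℚ K) → ℕ) := fun I => labelledNorm idx (normalizedFactors I)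
  have hF : ∀ I ∈ A, ∏ k, F I k = Ideal.absNorm I := fun I hI => by
    rw [prod_labelledNorm, Ideal.prod_normalizedFactors_eq_self (hA I hI).1]
  have hN : ∀ I ∈ A, 0 < Ideal.absNorm I := fun I hI =>
    Nat.pos_of_ne_zero (Ideal.absNorm_eq_zero_iff.not.2 (hA I hI).1)
  have hmaps : ∀ I ∈ A, F I ∈ Fintype.piFinset fun _ : Fin (finrank ℚ K) =>
      Finset.range (⌊x⌋₊ + 1) := by
    intro I hI
    rw [Fintype.mem_piFinset]
    intro k
    rw [Finset.mem_range, Nat.lt_succ_iff]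
    refine (Nat.le_of_dvd (hN I hI) ?_).trans (Nat.le_floor (hA I hI).2)
    rw [← hF I hI]
    exact Finset.dvd_prod_of_mem _ (Finset.mem_univ k)
  have hsum : Summable fun m : ℕ => (m : ℝ) ^ (-s) := Real.summable_nat_rpow.2 (by linarith)
  have h1 : ∀ I ∈ A, (1 : ℝ) ≤ x ^ s * ∏ k, (F I k : ℝ) ^ (-s) := by
    intro I hI
    have hpos : (0 : ℝ) < Ideal.absNorm I := by exact_mod_cast hN I hI
    rw [Real.finsetProd_rpow _ _ (fun _ _ => Nat.cast_nonneg _), ← Nat.cast_prod, hF I hI,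
      Real.rpow_neg hpos.le, ← div_eq_mul_inv, one_le_div (by positivity)]
    exact Real.rpow_le_rpow hpos.le (hA I hI).2 (by linarith)
  rw [Set.ncard_eq_toFinset_card _ hfin]
  calc (A.card : ℝ) = ∑ I ∈ A, (1 : ℝ) := by simp
    _ ≤ ∑ I ∈ A, x ^ s * ∏ k, (F I k : ℝ) ^ (-s) := Finset.sum_le_sum h1
    _ = x ^ s * ∑ I ∈ A, ∏ k, (F I k : ℝ) ^ (-s) := by rw [Finset.mul_sum]
    _ = x ^ s * ∑ m ∈ A.image F, ∏ k, (m k : ℝ) ^ (-s) := by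
        rw [Finset.sum_image]
        intro I hI J hJ h
        exact labelledNorm_injOn hidx (hA I hI).1 (hA J hJ).1 h
    _ ≤ x ^ s * ∑ m ∈ Fintype.piFinset fun _ : Fin (finrank ℚ K) => Finset.range (⌊x⌋₊ + 1),
          ∏ k, (m k : ℝ) ^ (-s) := by
        gcongr
        intro m hm
        obtain ⟨I, hI, rfl⟩ := Finset.mem_image.1 hm
        exact hmaps I hI
    _ = x ^ s * (∑ m ∈ Finset.range (⌊x⌋₊ + 1), (m : ℝ) ^ (-s)) ^ finrank ℚ K := by
        rw [Finset.sum_prod_piFinset (Finset.range (⌊x⌋₊ + 1)) (fun _ m => (m : ℝ) ^ (-s))]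
        simp
    _ ≤ x ^ s * (∑' m : ℕ, (m : ℝ) ^ (-s)) ^ finrank ℚ K := by
        gcongr
        exact hsum.sum_le_tsum _ fun _ _ => by positivity
    _ = _ := mul_comm _ _

end IdealCount

/-! ### Minkowski's theorem for metrized ideals -/

section Minkowski

variable {K : Type*} [Field K] [NumberField K]

open mixedEmbedding in
/-- A nonzero ideal contains a nonzero element whose absolute values are bounded by prescribed
weights, normalized so that their product is the norm of the ideal, up to a factor of size
`|disc K| ^ (1 / 2n)`. -/
theorem exists_mem_ideal_lt {I : Ideal (𝓞 K)} (hI : I ≠ ⊥) {f : InfinitePlace K → ℝ}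
    (hf : ∀ v, 0 < f v) (hprod : ∏ v, f v ^ v.mult = Ideal.absNorm I) {B : ℝ} (hB : 0 ≤ B)
    (hBn : 2 ^ finrank ℚ K * √|(discr K : ℝ)| < B ^ finrank ℚ K) :
    ∃ x ∈ I, x ≠ 0 ∧ ∀ v : InfinitePlace K, v (x : K) < B * f v := by
  classical
  let J : (FractionalIdeal (𝓞 K)⁰ K)ˣ :=
    FractionalIdeal.mk0 K ⟨I, mem_nonZeroDivisors_of_ne_zero hI⟩
  have hJ : (J : FractionalIdeal (𝓞 K)⁰ K) = I := by simp [J]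
  let g : InfinitePlace K → NNReal := fun v => (B * f v).toNNReal
  have hgv : ∀ v, (g v : ℝ) = B * f v := fun v => Real.coe_toNNReal _ (mul_nonneg hB (hf v).le)
  have hN : (0 : ℝ) < Ideal.absNorm I := by
    exact_mod_cast Nat.pos_of_ne_zero (Ideal.absNorm_eq_zero_iff.not.2 hI)
  have hg : ((∏ v, g v ^ v.mult : NNReal) : ℝ) = B ^ finrank ℚ K * Ideal.absNorm I := by
    push_cast
    simp only [hgv, mul_pow, Finset.prod_mul_distrib, hprod]
    rw [Finset.prod_pow_eq_pow_sum, InfinitePlace.sum_mult_eq]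
  have hlt : minkowskiBound K J < MeasureTheory.volume (convexBodyLT K g) := by
    rw [minkowskiBound, volume_fundamentalDomain_fractionalIdealLatticeBasis,
      volume_fundamentalDomain_latticeBasis, convexBodyLT_volume, hJ,
      FractionalIdeal.coeIdeal_absNorm, mixedEmbedding.finrank]
    have h1 : (1 : ENNReal) ≤ (convexBodyLTFactor K : ENNReal) := by
      exact_mod_cast one_le_convexBodyLTFactor K
    calc _ ≤ ENNReal.ofReal (Ideal.absNorm I) * (1 * (NNReal.sqrt ‖discr K‖₊ : ENNReal)) *
          2 ^ finrank ℚ K := by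
          gcongr
          · simp
          · exact pow_le_one₀ (by simp) (by simp)
      _ = ENNReal.ofReal (Ideal.absNorm I * (2 ^ finrank ℚ K * √|(discr K : ℝ)|)) := by
          rw [ENNReal.ofReal_mul hN.le, ENNReal.ofReal_mul (by positivity)]
          have : (NNReal.sqrt ‖discr K‖₊ : ENNReal) = ENNReal.ofReal √|(discr K : ℝ)| := by
            rw [ENNReal.ofReal, Real.sqrt]
            congr 2
            ext
            simp [Int.norm_eq_abs]
          rw [this, ENNReal.ofReal_pow (by norm_num)]
          simp
          ring
      _ < ENNReal.ofReal ((∏ v, g v ^ v.mult : NNReal) : ℝ) := by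
          rw [ENNReal.ofReal_lt_ofReal_iff_of_nonneg (by positivity), hg, mul_comm (B ^ _)]
          exact mul_lt_mul_of_pos_left hBn hN
      _ = 1 * ((∏ v, g v ^ v.mult : NNReal) : ENNReal) := by
          rw [ENNReal.ofReal_coe_nnreal, one_mul]
      _ ≤ _ := by
          have e : ((∏ v, g v ^ v.mult : NNReal) : ENNReal) = ∏ v, (g v : ENNReal) ^ v.mult := by
            push_cast
            rfl
          rw [e]
          gcongr
  obtain ⟨a, ha, ha0, hlt⟩ := exists_ne_zero_mem_ideal_lt K J hlt
  rw [hJ, FractionalIdeal.mem_coeIdeal] at ha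
  obtain ⟨x, hx, rfl⟩ := ha
  exact ⟨x, hx, by rintro rfl; simp at ha0, fun v => hgv v ▸ hlt v⟩

end Minkowski

/-! ### The pigeonhole argument in the Arakelov class group -/

section Pigeonhole

variable {K : Type*} [Field K] [NumberField K]

theorem absNorm_cast_pos {I : Ideal (𝓞 K)} (hI : I ≠ ⊥) : (0 : ℝ) < Ideal.absNorm I :=
  Nat.cast_pos.2 (Nat.pos_of_ne_zero (Ideal.absNorm_eq_zero_iff.not.2 hI))

theorem prod_infinitePlace_eq_absNorm (x : 𝓞 K) :
    ∏ v : InfinitePlace K, v (x : K) ^ v.mult = Ideal.absNorm (Ideal.span {x}) := by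
  rw [InfinitePlace.prod_eq_abs_norm, Ideal.absNorm_span_singleton, ← Algebra.coe_norm_int]
  push_cast
  simp [Nat.cast_natAbs]

theorem card_infinitePlace_le_finrank : Fintype.card (InfinitePlace K) ≤ finrank ℚ K := by
  rw [← InfinitePlace.sum_mult_eq, Fintype.card, Finset.card_eq_sum_ones]
  exact Finset.sum_le_sum fun v _ => v.mult_pos

/-- A class killed by `ℓ` is represented by an ideal `I` with `I ^ ℓ = (g)`; the `ℓ`-th roots of the
absolute values of `g` turn `I` into an `ℓ`-torsion point of the Arakelov class group. -/
theorem exists_torsion_representative {ℓ : ℕ} (hℓ : ℓ ≠ 0) (c : ClassGroup (𝓞 K)) (hc : c ^ ℓ = 1) :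
    ∃ (I : (Ideal (𝓞 K))⁰) (g : 𝓞 K) (s : InfinitePlace K → ℝ), ClassGroup.mk0 I = c ∧
      Ideal.span {g} = (I : Ideal (𝓞 K)) ^ ℓ ∧ (∀ v, 0 < s v) ∧ (∀ v, s v ^ ℓ = v (g : K)) ∧
      ∏ v, s v ^ v.mult = Ideal.absNorm (I : Ideal (𝓞 K)) := by
  obtain ⟨I, rfl⟩ := ClassGroup.mk0_surjective c
  have hI : (I : Ideal (𝓞 K)) ≠ ⊥ := nonZeroDivisors.ne_zero I.2
  rw [← map_pow] at hc
  obtain ⟨g, hg⟩ :=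
    ((ClassGroup.mk0_eq_one_iff (I := (I : Ideal (𝓞 K)) ^ ℓ) (pow_mem I.2 ℓ)).1 hc).principal
  replace hg : Ideal.span {g} = (I : Ideal (𝓞 K)) ^ ℓ := hg.symm
  have hg0 : (g : K) ≠ 0 := by
    intro h
    have : g = 0 := by exact_mod_cast h
    rw [this, Ideal.span_singleton_zero] at hg
    exact pow_ne_zero ℓ hI hg.symm
  have hs : ∀ v : InfinitePlace K, (v (g : K) ^ (1 / (ℓ : ℝ))) ^ ℓ = v (g : K) := fun v => by
    rw [one_div, Real.rpow_inv_natCast_pow (apply_nonneg _ _) hℓ]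
  have hpos : ∀ v : InfinitePlace K, 0 < v (g : K) ^ (1 / (ℓ : ℝ)) := fun v =>
    Real.rpow_pos_of_pos (InfinitePlace.pos_iff.2 hg0) _
  refine ⟨I, g, fun v => v (g : K) ^ (1 / (ℓ : ℝ)), rfl, hg, hpos, hs, ?_⟩
  rw [← pow_left_inj₀ (Finset.prod_nonneg fun v _ => pow_nonneg (hpos v).le _)
    (Nat.cast_nonneg _) hℓ, ← Finset.prod_pow]
  simp_rw [← pow_mul, mul_comm _ ℓ, pow_mul, hs]
  rw [prod_infinitePlace_eq_absNorm, hg, map_pow]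
  push_cast
  rfl

/-- Reduction of the metrized ideal `(I, f)`: a short element `x` of `I` has a cofactor of norm at
most `B ^ n`, and all its absolute values are of the size predicted by `f`, up to bounded powers
of `B`. -/
theorem exists_reduction {I : Ideal (𝓞 K)} (hI : I ≠ ⊥) {f : InfinitePlace K → ℝ}
    (hf : ∀ v, 0 < f v) (hprod : ∏ v, f v ^ v.mult = Ideal.absNorm I) {B : ℝ} (hB : 1 ≤ B)
    (hBn : 2 ^ finrank ℚ K * √|(discr K : ℝ)| < B ^ finrank ℚ K) :
    ∃ (x : 𝓞 K) (A : Ideal (𝓞 K)), x ≠ 0 ∧ A ≠ ⊥ ∧ Ideal.span {x} = I * A ∧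
      (Ideal.absNorm A : ℝ) ≤ B ^ finrank ℚ K ∧
      ∀ v : InfinitePlace K, Real.log (v (x : K) / f v) ≤ Real.log B ∧
        -(finrank ℚ K * Real.log B) ≤ Real.log (v (x : K) / f v) := by
  classical
  obtain ⟨x, hxI, hx0, hx⟩ := exists_mem_ideal_lt hI hf hprod (by linarith) hBn
  obtain ⟨A, hA⟩ := Ideal.dvd_span_singleton.2 hxI
  have hA0 : A ≠ ⊥ := by
    rintro rfl
    rw [Ideal.mul_bot, Ideal.span_singleton_eq_bot] at hA
    exact hx0 hA
  have hNI := absNorm_cast_pos hI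
  have hvx : ∀ v : InfinitePlace K, 0 < v (x : K) := fun v =>
    InfinitePlace.pos_iff.2 (by exact_mod_cast hx0)
  have ht : ∀ v : InfinitePlace K, 0 < v (x : K) / f v := fun v => div_pos (hvx v) (hf v)
  have htB : ∀ v : InfinitePlace K, v (x : K) / f v ≤ B := fun v =>
    (div_le_iff₀ (hf v)).2 (hx v).le
  have hprodt : ∏ v : InfinitePlace K, (v (x : K) / f v) ^ v.mult = Ideal.absNorm A := by
    simp_rw [div_pow]
    rw [Finset.prod_div_distrib, hprod, prod_infinitePlace_eq_absNorm, hA, map_mul]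
    push_cast
    field_simp
  have hlogB : 0 ≤ Real.log B := Real.log_nonneg hB
  have hup : ∀ v : InfinitePlace K, Real.log (v (x : K) / f v) ≤ Real.log B := fun v =>
    Real.log_le_log (ht v) (htB v)
  refine ⟨x, A, hx0, hA0, hA, ?_, fun v => ⟨hup v, ?_⟩⟩
  · rw [← hprodt, ← InfinitePlace.sum_mult_eq, ← Finset.prod_pow_eq_pow_sum]
    exact Finset.prod_le_prod (fun v _ => pow_nonneg (ht v).le _)
      fun v _ => pow_le_pow_left₀ (ht v).le (htB v) _
  · have h1 : 0 ≤ ∑ w : InfinitePlace K, w.mult * Real.log (w (x : K) / f w) := by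
      have : Real.log (∏ v : InfinitePlace K, (v (x : K) / f v) ^ v.mult) =
          ∑ w : InfinitePlace K, w.mult * Real.log (w (x : K) / f w) := by
        rw [Real.log_prod fun v _ => (pow_pos (ht v) _).ne']
        simp_rw [Real.log_pow]
      rw [← this, hprodt]
      exact Real.log_natCast_nonneg _
    have h2 : ∑ w : InfinitePlace K, w.mult * Real.log (w (x : K) / f w) ≤
        v.mult * Real.log (v (x : K) / f v) + finrank ℚ K * Real.log B := by
      rw [← Finset.add_sum_erase _ _ (Finset.mem_univ v), ← InfinitePlace.sum_mult_eq]
      push_cast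
      rw [Finset.sum_mul]
      gcongr
      calc _ ≤ ∑ w ∈ Finset.univ.erase v, (w.mult : ℝ) * Real.log B :=
            Finset.sum_le_sum fun w _ => mul_le_mul_of_nonneg_left (hup w) (Nat.cast_nonneg _)
        _ ≤ _ := Finset.sum_le_sum_of_subset_of_nonneg (Finset.erase_subset _ _)
            fun w _ _ => by positivity
    have hm : (1 : ℝ) ≤ v.mult := by exact_mod_cast v.mult_pos
    have hn : 0 ≤ (finrank ℚ K : ℝ) * Real.log B := by positivity
    by_contra! hlt
    nlinarith

theorem le_exp_mul_of_floor_log_eq {η s t : ℝ} (hη : 0 < η) (hs : 0 < s) (ht : 0 < t)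
    (h : ⌊Real.log s / η⌋ = ⌊Real.log t / η⌋) : s ≤ Real.exp η * t := by
  have h1 := (abs_lt.1 (Int.abs_sub_lt_one_of_floor_eq_floor h)).2
  rw [← sub_div, div_lt_one hη] at h1
  rw [← Real.log_le_log_iff hs (by positivity), Real.log_mul (by positivity) ht.ne', Real.log_exp]
  linarith

/-- The pigeonhole step, in the Arakelov class group. The translates of the `ℓ`-torsion points by
the ideals of `T` are reduced to ideals of norm at most `B ^ n` together with a point of a box of
side `(n + 1) log B`, which is cut into cubes of side `η`. If no two distinct ideals `P`, `Q` of `T`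
have `(P / Q) ^ ℓ` generated by an element with all absolute values small, then no two of these
reductions share the ideal and the cube. Here `r P` is the `n`-th root of the norm of `P`, the
weight that makes `P` a point of degree zero. -/
theorem card_torsion_mul_card_le {ℓ : ℕ} (hℓ : ℓ ≠ 0) (T : Finset (Ideal (𝓞 K)))
    (h0 : ∀ P ∈ T, P ≠ ⊥) {B η : ℝ} (hB : 1 ≤ B) (hη : 0 < η)
    (hBn : 2 ^ finrank ℚ K * √|(discr K : ℝ)| < B ^ finrank ℚ K)
    (r : Ideal (𝓞 K) → ℝ) (hr : ∀ P ∈ T, 0 < r P)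
    (hrn : ∀ P ∈ T, r P ^ finrank ℚ K = Ideal.absNorm P)
    (hcol : ∀ P ∈ T, ∀ Q ∈ T, P ≠ Q → ∀ (J : Ideal (𝓞 K)) (a b : 𝓞 K), a ≠ 0 → b ≠ 0 →
      Ideal.span {a} = J * P ^ ℓ → Ideal.span {b} = J * Q ^ ℓ →
      ¬ ∀ v : InfinitePlace K, v (a : K) * r Q ^ ℓ ≤ Real.exp η ^ ℓ * (v (b : K) * r P ^ ℓ)) :
    (Nat.card {c : ClassGroup (𝓞 K) // c ^ ℓ = 1} : ℝ) * T.card ≤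
      {I : Ideal (𝓞 K) | I ≠ ⊥ ∧ (Ideal.absNorm I : ℝ) ≤ B ^ finrank ℚ K}.ncard *
        ((finrank ℚ K + 1) * Real.log B / η + 2) ^ finrank ℚ K := by
  classical
  set n := finrank ℚ K
  choose I g s hIc hg hs hsg hsI using fun c : {c : ClassGroup (𝓞 K) // c ^ ℓ = 1} =>
    exists_torsion_representative hℓ c.1 c.2
  have hI0 : ∀ c, (I c : Ideal (𝓞 K)) ≠ ⊥ := fun c => nonZeroDivisors.ne_zero (I c).2
  have hred : ∀ z : {c : ClassGroup (𝓞 K) // c ^ ℓ = 1} × {P // P ∈ T},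
      ∃ (x : 𝓞 K) (A : Ideal (𝓞 K)), x ≠ 0 ∧ A ≠ ⊥ ∧
        Ideal.span {x} = (I z.1 * z.2.1 : Ideal (𝓞 K)) * A ∧ (Ideal.absNorm A : ℝ) ≤ B ^ n ∧
        ∀ v : InfinitePlace K, Real.log (v (x : K) / (s z.1 v * r z.2.1)) ≤ Real.log B ∧
          -(n * Real.log B) ≤ Real.log (v (x : K) / (s z.1 v * r z.2.1)) := by
    intro z
    refine exists_reduction (mul_ne_zero (hI0 z.1) (h0 _ z.2.2))
      (fun v => mul_pos (hs _ _) (hr _ z.2.2)) ?_ hB hBn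
    simp_rw [mul_pow]
    rw [Finset.prod_mul_distrib, hsI, Finset.prod_pow_eq_pow_sum, InfinitePlace.sum_mult_eq,
      hrn _ z.2.2, map_mul, Nat.cast_mul]
  choose x A hx0 hA0 hxA hAB hlog using hred
  have hfin := finite_ideals_absNorm_le K (B ^ n)
  let lo : ℤ := ⌊-(n * Real.log B) / η⌋
  let hi : ℤ := ⌊Real.log B / η⌋
  let key : {c : ClassGroup (𝓞 K) // c ^ ℓ = 1} × {P // P ∈ T} →
      Ideal (𝓞 K) × (InfinitePlace K → ℤ) := fun z =>
    (A z, fun v => ⌊Real.log (v (x z : K) / (s z.1 v * r z.2.1)) / η⌋)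
  have hmem : ∀ z, key z ∈ hfin.toFinset ×ˢ
      Fintype.piFinset fun _ : InfinitePlace K => Finset.Icc lo hi := by
    intro z
    simp only [key, Finset.mem_product, Set.Finite.mem_toFinset, Fintype.mem_piFinset,
      Finset.mem_Icc]
    exact ⟨⟨hA0 z, hAB z⟩, fun v =>
      ⟨Int.floor_le_floor (div_le_div_of_nonneg_right (hlog z v).2 hη.le),
      Int.floor_le_floor (div_le_div_of_nonneg_right (hlog z v).1 hη.le)⟩⟩
  have hinj : Function.Injective key := by
    intro z z' hzz
    obtain ⟨hAA, hfl⟩ := Prod.ext_iff.1 hzz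
    simp only [key] at hAA hfl
    by_cases hPQ : z.2.1 = z'.2.1
    -- For equal ideals `P` the torsion classes agree: each is inverse to the class of `P * A z`.
    · have hc : ∀ w : {c : ClassGroup (𝓞 K) // c ^ ℓ = 1} × {P // P ∈ T},
          (w.1.1 : ClassGroup (𝓞 K)) *
            ClassGroup.mk0 ⟨w.2.1 * A w, mem_nonZeroDivisors_of_ne_zero
              (mul_ne_zero (h0 _ w.2.2) (hA0 w))⟩ = 1 := by
        intro w
        rw [← hIc w.1, ← map_mul]
        refine (ClassGroup.mk0_eq_one_iff (I := (I w.1 : Ideal (𝓞 K)) * (w.2.1 * A w)) _).2 ?_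
        rw [← mul_assoc, ← hxA w]
        exact ⟨_, rfl⟩
      have h1 := hc z
      have h2 := hc z'
      simp only [← hPQ, ← hAA] at h2
      exact Prod.ext (Subtype.ext (mul_right_cancel (h1.trans h2.symm))) (Subtype.ext hPQ)
    · exfalso
      have hg0 : ∀ c, g c ≠ 0 := fun c h => by
        have := hg c
        rw [h, Ideal.span_singleton_zero] at this
        exact pow_ne_zero ℓ (hI0 c) this.symm
      -- The quotient `x z / x z'` generates `I P / (I' Q)`; its `ℓ`-th power times `g' / g`
      -- generates `(P / Q) ^ ℓ`, and the weights `s ^ ℓ = |g|` cancel.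
      refine hcol _ z.2.2 _ z'.2.2 hPQ ((I z.1 * I z'.1 * A z : Ideal (𝓞 K)) ^ ℓ)
        (x z ^ ℓ * g z'.1) (x z' ^ ℓ * g z.1) (mul_ne_zero (pow_ne_zero _ (hx0 z)) (hg0 _))
        (mul_ne_zero (pow_ne_zero _ (hx0 z')) (hg0 _)) ?_ ?_ fun v => ?_
      · rw [← Ideal.span_singleton_mul_span_singleton, ← Ideal.span_singleton_pow, hxA, hg,
          ← mul_pow, ← mul_pow]
        ring
      · rw [← Ideal.span_singleton_mul_span_singleton, ← Ideal.span_singleton_pow, hxA, hg,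
          ← mul_pow, ← mul_pow, hAA]
        ring
      · have hvx : ∀ w, 0 < v (x w : K) := fun w =>
          InfinitePlace.pos_iff.2 (by exact_mod_cast hx0 w)
        have hfv : ∀ w : {c : ClassGroup (𝓞 K) // c ^ ℓ = 1} × {P // P ∈ T},
          0 < s w.1 v * r w.2.1 := fun w => mul_pos (hs _ _) (hr _ w.2.2)
        have hle := le_exp_mul_of_floor_log_eq hη (div_pos (hvx z) (hfv z))
          (div_pos (hvx z') (hfv z')) (congr_fun hfl v)
        have := hs z.1 v
        have := hs z'.1 v
        have := hr _ z.2.2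
        have := hr _ z'.2.2
        rw [← mul_div_assoc, div_le_div_iff₀ (hfv z) (hfv z')] at hle
        push_cast
        rw [map_mul, map_mul, map_pow, map_pow, ← hsg, ← hsg]
        simp only [← mul_pow]
        refine pow_le_pow_left₀ (by have := hvx z; positivity) ?_ _
        linarith
  have hcard := Finset.card_le_card_of_injOn key (s := Finset.univ) (fun z _ => hmem z) hinj.injOn
  rw [Finset.card_product, Fintype.card_piFinset, Finset.prod_const, Finset.card_univ,
    Fintype.card_prod, Fintype.card_coe, ← Nat.card_eq_fintype_card, Int.card_Icc,
    ← Set.ncard_eq_toFinset_card _ hfin, Finset.card_univ] at hcard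
  have hlogB : 0 ≤ Real.log B := Real.log_nonneg hB
  have hbox : (((hi + 1 - lo).toNat : ℕ) : ℝ) ≤ (n + 1) * Real.log B / η + 2 := by
    have h1 : (hi : ℝ) ≤ Real.log B / η := Int.floor_le _
    have h2 : -(n * Real.log B) / η < lo + 1 := Int.lt_floor_add_one _
    have h3 : 0 ≤ (n + 1) * Real.log B / η + 2 := by positivity
    have e : (n + 1) * Real.log B / η = Real.log B / η - -(n * Real.log B) / η := by ring
    have h4 : (((hi + 1 - lo).toNat : ℤ) : ℝ) ≤ (n + 1) * Real.log B / η + 2 := by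
      rw [Int.toNat_eq_max]
      push_cast
      refine max_le ?_ h3
      rw [e]
      linarith
    exact_mod_cast h4
  have hbase : 1 ≤ (n + 1) * Real.log B / η + 2 := by
    have : 0 ≤ (n + 1) * Real.log B / η := by positivity
    linarith
  refine (show _ ≤ ((_ : ℕ) : ℝ) by exact_mod_cast hcard).trans ?_
  push_cast
  gcongr
  exact (pow_le_pow_left₀ (Nat.cast_nonneg _) hbox _).trans
    (pow_le_pow_right₀ hbase card_infinitePlace_le_finrank)

end Pigeonhole

/-! ### Heights and generators -/

section Height

variable {K : Type*} [Field K] [NumberField K]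

/-- The height of a generator `a / b` of `(P / Q) ^ ℓ`, with `P`, `Q` coprime of norm at most
`y ^ n`, whose absolute values are those forced by the product formula up to the factor `e ^ ℓ`. -/
theorem mulHeight₁_div_le {ℓ : ℕ} {J P Q : Ideal (𝓞 K)} {a b : 𝓞 K} (ha0 : a ≠ 0)
    (ha : Ideal.span {a} = J * P ^ ℓ) (hb : Ideal.span {b} = J * Q ^ ℓ) (hPQ : IsCoprime P Q)
    {rP rQ y e : ℝ} (hrP : 0 < rP) (hrQ : 0 < rQ) (he : 1 ≤ e) (hPy : rP ≤ y) (hQy : rQ ≤ y)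
    (hQn : rQ ^ finrank ℚ K = Ideal.absNorm Q)
    (hv : ∀ v : InfinitePlace K, v (a : K) * rQ ^ ℓ ≤ e ^ ℓ * (v (b : K) * rP ^ ℓ)) :
    Height.mulHeight₁ ((a : K) / (b : K)) ≤ ((e * y) ^ finrank ℚ K) ^ ℓ := by
  set n := finrank ℚ K
  have hx0 : (![a, b] : Fin 2 → 𝓞 K) ≠ 0 := fun h => ha0 (congr_fun h 0)
  have hx0' : (![(a : K), (b : K)] : Fin 2 → K) ≠ 0 := fun h =>
    RingOfIntegers.coe_ne_zero_iff.2 ha0 (congr_fun h 0)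
  have hJ0 : J ≠ ⊥ := by
    rintro rfl
    rw [Ideal.bot_mul, Ideal.span_singleton_eq_bot] at ha
    exact ha0 ha
  have hQ0 : (0 : ℝ) < Ideal.absNorm Q := by rw [← hQn]; positivity
  have hJ := absNorm_cast_pos hJ0
  have hspan : Ideal.span (Set.range ![a, b]) = J := by
    rw [Matrix.range_cons, Matrix.range_cons, Matrix.range_empty, Set.union_empty, Ideal.span_union,
      ha, hb, ← Ideal.mul_sup, Ideal.isCoprime_iff_sup_eq.1 hPQ.pow, Ideal.mul_top]
  have hfin := absNorm_mul_finprod_finitePlace_eq_one hx0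
  rw [hspan] at hfin
  have hsup : ∀ v : InfinitePlace K, (⨆ i, v (![(a : K), (b : K)] i)) =
      max (v (a : K)) (v (b : K)) := by
    intro v
    rw [← Finset.sup'_univ_eq_ciSup]
    simp [Fin.univ_succ, Finset.sup'_insert]
  have hmax : ∀ v : InfinitePlace K,
      max (v (a : K)) (v (b : K)) * rQ ^ ℓ ≤ (e * y) ^ ℓ * v (b : K) := by
    intro v
    have h1 : 0 ≤ v (b : K) := apply_nonneg _ _
    have h2 : rP ^ ℓ ≤ y ^ ℓ := pow_le_pow_left₀ hrP.le hPy _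
    have h3 : rQ ^ ℓ ≤ y ^ ℓ := pow_le_pow_left₀ hrQ.le hQy _
    have h4 : 1 ≤ e ^ ℓ := one_le_pow₀ he
    have h5 : 0 ≤ y ^ ℓ := (pow_nonneg hrP.le _).trans h2
    rw [max_mul_of_nonneg _ _ (pow_nonneg hrQ.le _), mul_pow]
    refine max_le ((hv v).trans ?_) ?_
    · rw [mul_comm (v (b : K)), ← mul_assoc]
      gcongr
    · rw [mul_comm]
      gcongr
      nlinarith
  have hinf : (∏ v : InfinitePlace K, max (v (a : K)) (v (b : K)) ^ v.mult) ≤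
      ((e * y) ^ n) ^ ℓ * Ideal.absNorm J := by
    have h1 : ∏ v : InfinitePlace K, (max (v (a : K)) (v (b : K)) * rQ ^ ℓ) ^ v.mult ≤
        ∏ v : InfinitePlace K, ((e * y) ^ ℓ * v (b : K)) ^ v.mult :=
      Finset.prod_le_prod (fun v _ => by positivity) fun v _ =>
        pow_le_pow_left₀ (by positivity) (hmax v) _
    simp_rw [mul_pow _ _ (InfinitePlace.mult _)] at h1
    rw [Finset.prod_mul_distrib, Finset.prod_mul_distrib, Finset.prod_pow_eq_pow_sum,
      Finset.prod_pow_eq_pow_sum, InfinitePlace.sum_mult_eq, prod_infinitePlace_eq_absNorm, hb,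
      map_mul, map_pow, ← pow_mul, mul_comm ℓ, pow_mul, hQn] at h1
    push_cast at h1
    rw [← mul_assoc, ← pow_mul, mul_comm ℓ, pow_mul] at h1
    exact le_of_mul_le_mul_right h1 (pow_pos hQ0 ℓ)
  rw [Height.mulHeight₁_div_eq_mulHeight, mulHeight_eq hx0']
  have hcoe : (fun v : FinitePlace K => ⨆ i, v (![(a : K), (b : K)] i)) =
      fun v : FinitePlace K => ⨆ i, v ((![a, b] i : 𝓞 K) : K) := by
    ext v
    congr 1
    ext i
    fin_cases i <;> rfl
  rw [hcoe]
  simp_rw [hsup]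
  have hfin' : ∏ᶠ v : FinitePlace K, ⨆ i, v ((![a, b] i : 𝓞 K) : K) = (Ideal.absNorm J : ℝ)⁻¹ :=
    eq_inv_of_mul_eq_one_right hfin
  rw [hfin', ← div_eq_mul_inv, div_le_iff₀ hJ]
  exact hinf

end Height

section Generator

variable {K : Type*} [Field K] [NumberField K]

/-- If `p` splits completely in `K` and `c` lies in exactly one prime above `p`, then `c` generates
`K`: a prime of a proper subfield has several primes of `K` above it. -/
theorem adjoin_eq_top_of_mem_unique_prime {p : ℕ}
    (hsplit : ∀ P ∈ (Ideal.span {(p : ℤ)}).primesOver (𝓞 K),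
      P.ramificationIdx ℤ = 1 ∧ P.inertiaDeg ℤ = 1)
    {P : Ideal (𝓞 K)} (hP : P ∈ (Ideal.span {(p : ℤ)}).primesOver (𝓞 K)) {c : 𝓞 K} (hcP : c ∈ P)
    (hc : ∀ P' ∈ (Ideal.span {(p : ℤ)}).primesOver (𝓞 K), c ∈ P' → P' = P) :
    ℚ⟮(c : K)⟯ = ⊤ := by
  classical
  set F := ℚ⟮(c : K)⟯
  have hF : NumberField F := { }
  have hPp := hP.1
  have hPo := hP.2
  set q : Ideal (𝓞 F) := P.under (𝓞 F)
  have hint : IsIntegral ℤ (AdjoinSimple.gen ℚ (c : K)) := by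
    rw [← isIntegral_algebraMap_iff (algebraMap F K).injective, AdjoinSimple.algebraMap_gen]
    exact c.2
  let c' : 𝓞 F := ⟨AdjoinSimple.gen ℚ (c : K), hint⟩
  have hc' : algebraMap (𝓞 F) (𝓞 K) c' = c := by
    ext
    rfl
  have hc'q : c' ∈ q := by
    rw [Ideal.mem_comap, hc']
    exact hcP
  have hqp : q.LiesOver (Ideal.span {(p : ℤ)}) := Ideal.LiesOver.tower_bot P q _
  have huniq : q.primesOver (𝓞 K) = {P} := by
    ext P'
    constructor
    · rintro ⟨h1, h2⟩
      refine hc P' ⟨h1, Ideal.LiesOver.trans P' q _⟩ ?_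
      rw [h2.over, Ideal.mem_comap, hc'] at hc'q
      exact hc'q
    · rintro rfl
      exact ⟨hPp, ⟨rfl⟩⟩
  have hfin : (q.primesOver (𝓞 K)).Finite := by rw [huniq]; exact Set.finite_singleton _
  let := hfin.fintype
  have hsum := Ideal.sum_ramification_inertia_eq_finrank q (𝓞 K)
  have he := Ideal.ramificationIdx_above_dvd (R := ℤ) q P
  have hf := Ideal.inertiaDeg_above_dvd (R := ℤ) q P
  rw [(hsplit P hP).1, Nat.dvd_one] at he
  rw [(hsplit P hP).2, Nat.dvd_one] at hf
  have h : ∀ z : q.primesOver (𝓞 K), (z : Ideal (𝓞 K)) = P := fun z =>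
    (Set.ext_iff.1 huniq z).1 z.2
  have hone : finrank (𝓞 F) (𝓞 K) = 1 := by
    rw [← hsum]
    have : Unique (q.primesOver (𝓞 K)) := by
      rw [huniq]
      infer_instance
    rw [Fintype.sum_unique, h, he, hf]
  rw [← IntermediateField.finrank_eq_one_iff_eq_top, ← hone]
  exact IsFractionRing.finrank_eq (𝓞 F) F (𝓞 K) K

theorem absNorm_of_inertiaDeg_eq_one {p : ℕ} (hp : p.Prime) {P : Ideal (𝓞 K)}
    (hP : P ∈ (Ideal.span {(p : ℤ)}).primesOver (𝓞 K)) (hf : P.inertiaDeg ℤ = 1) :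
    Ideal.absNorm P = p := by
  have := isMaximal_span_natCast hp
  have := isMaximal_of_mem_primesOver hp hP
  have := hP.2
  rw [Ideal.absNorm_eq_pow_inertiaDeg' P hp, Ideal.inertiaDeg'_eq_inertiaDeg, hf, pow_one]

/-- Let `P`, `Q` be primes above distinct rational primes, the first of which splits completely.
Then a generator of `(P / Q) ^ ℓ` generates `K`. -/
theorem adjoin_div_eq_top {ℓ p q : ℕ} (hℓ : ℓ ≠ 0) (hp : p.Prime) (hq : q.Prime) (hpq : p ≠ q)
    (hsplit : ∀ P ∈ (Ideal.span {(p : ℤ)}).primesOver (𝓞 K),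
      P.ramificationIdx ℤ = 1 ∧ P.inertiaDeg ℤ = 1)
    {J P Q : Ideal (𝓞 K)} (hP : P ∈ (Ideal.span {(p : ℤ)}).primesOver (𝓞 K))
    (hQ : Q ∈ (Ideal.span {(q : ℤ)}).primesOver (𝓞 K)) {a b : 𝓞 K} (hb0 : b ≠ 0)
    (ha : Ideal.span {a} = J * P ^ ℓ) (hb : Ideal.span {b} = J * Q ^ ℓ) :
    ℚ⟮(a : K) / (b : K)⟯ = ⊤ := by
  obtain ⟨Q', hQ'⟩ := Ideal.dvd_span_singleton.2 (natCast_mem_of_mem_primesOver hQ)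
  -- `c = q ^ ℓ * (a / b)` is integral and generates `Q' ^ ℓ * P ^ ℓ`.
  have hqa : Ideal.span {(q : 𝓞 K) ^ ℓ * a} = Ideal.span {b} * (Q' ^ ℓ * P ^ ℓ) := by
    rw [← Ideal.span_singleton_mul_span_singleton, ← Ideal.span_singleton_pow, hQ', ha, hb]
    ring
  obtain ⟨c, hc⟩ : b ∣ (q : 𝓞 K) ^ ℓ * a := by
    rw [← Ideal.span_singleton_le_span_singleton, hqa]
    exact Ideal.mul_le_left
  have hcspan : Ideal.span {c} = Q' ^ ℓ * P ^ ℓ := by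
    rw [hc, ← Ideal.span_singleton_mul_span_singleton] at hqa
    exact mul_left_cancel₀ (by simpa using hb0) hqa
  have hcP : c ∈ P := by
    rw [← Ideal.span_singleton_le_iff_mem, hcspan]
    exact Ideal.mul_le_right.trans (Ideal.pow_le_self hℓ)
  have hcuniq : ∀ P' ∈ (Ideal.span {(p : ℤ)}).primesOver (𝓞 K), c ∈ P' → P' = P := by
    intro P' hP' hcP'
    have hprime := hP'.1
    rw [← Ideal.span_singleton_le_iff_mem, hcspan, hprime.mul_le] at hcP'
    rcases hcP' with h | h
    · exfalso
      have hqP' : (q : 𝓞 K) ∈ P' := by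
        refine hprime.le_of_pow_le h ?_
        rw [← Ideal.span_singleton_le_iff_mem, hQ']
        exact Ideal.mul_le_right
      have hpP' := natCast_mem_of_mem_primesOver hP'
      obtain ⟨u, w, huw⟩ := Nat.isCoprime_iff_coprime.2 ((Nat.coprime_primes hp hq).2 hpq)
      apply hprime.ne_top
      rw [Ideal.eq_top_iff_one]
      have := P'.add_mem (P'.mul_mem_left (u : 𝓞 K) hpP') (P'.mul_mem_left (w : 𝓞 K) hqP')
      have e : (u : 𝓞 K) * p + w * q = 1 := by exact_mod_cast congrArg (Int.cast : ℤ → 𝓞 K) huw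
      rwa [e] at this
    · exact ((isMaximal_of_mem_primesOver hp hP).eq_of_le hprime.ne_top
        (hprime.le_of_pow_le h)).symm
  have htop := adjoin_eq_top_of_mem_unique_prime hsplit hP hcP hcuniq
  rw [eq_top_iff, ← htop, adjoin_simple_le_iff]
  have hbK : (b : K) ≠ 0 := RingOfIntegers.coe_ne_zero_iff.2 hb0
  have hcK : (q : K) ^ ℓ * (a : K) = (b : K) * (c : K) := by
    exact_mod_cast congrArg (algebraMap (𝓞 K) K) hc
  have e : (c : K) = (q : K) ^ ℓ * ((a : K) / (b : K)) := by
    field_simp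
    rw [hcK, mul_comm]
  rw [e]
  exact mul_mem (pow_mem (IntermediateField.natCast_mem _ q) _) (mem_adjoin_simple_self ℚ _)

/-- The Ellenberg–Venkatesh bound: if no generator of `K` has small height, then primes that split
completely, in number `#T`, save a factor `#T` in the trivial bound for the `ℓ`-torsion. -/
theorem card_torsion_mul_card_split_le {ℓ : ℕ} (hℓ : ℓ ≠ 0) {Y : ℝ} (T : Finset ℕ)
    (hT : ∀ p ∈ T, p.Prime ∧ (p : ℝ) ≤ Y ∧ ∀ P ∈ (Ideal.span {(p : ℤ)}).primesOver (𝓞 K),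
      P.ramificationIdx ℤ = 1 ∧ P.inertiaDeg ℤ = 1)
    {B η : ℝ} (hB : 1 ≤ B) (hη : 0 < η)
    (hBn : 2 ^ finrank ℚ K * √|(discr K : ℝ)| < B ^ finrank ℚ K)
    (hgen : ∀ β : K, (∀ F : Subfield K, β ∈ F → F = ⊤) →
      (Real.exp η ^ finrank ℚ K * Y) ^ ℓ < Height.mulHeight₁ β) :
    (Nat.card {c : ClassGroup (𝓞 K) // c ^ ℓ = 1} : ℝ) * T.card ≤
      {I : Ideal (𝓞 K) | I ≠ ⊥ ∧ (Ideal.absNorm I : ℝ) ≤ B ^ finrank ℚ K}.ncard *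
        ((finrank ℚ K + 1) * Real.log B / η + 2) ^ finrank ℚ K := by
  classical
  set n := finrank ℚ K
  have hn0 : n ≠ 0 := finrank_pos.ne'
  have hover : ∀ p : ℕ, ∃ P : Ideal (𝓞 K), p.Prime →
      P ∈ (Ideal.span {(p : ℤ)}).primesOver (𝓞 K) := by
    intro p
    by_cases hp : p.Prime
    · have := isMaximal_span_natCast hp
      obtain ⟨P, hP, hPo⟩ := Ideal.exists_maximal_ideal_liesOver_of_isIntegral (S := 𝓞 K)
        (Ideal.span {(p : ℤ)})
      exact ⟨P, fun _ => ⟨hP.isPrime, hPo⟩⟩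
    · exact ⟨⊥, fun h => absurd h hp⟩
  choose P hP using hover
  have hPT : ∀ p ∈ T, P p ∈ (Ideal.span {(p : ℤ)}).primesOver (𝓞 K) := fun p hp => hP p (hT p hp).1
  have hN : ∀ p ∈ T, Ideal.absNorm (P p) = p := fun p hp =>
    absNorm_of_inertiaDeg_eq_one (hT p hp).1 (hPT p hp) ((hT p hp).2.2 _ (hPT p hp)).2
  have hinj : Set.InjOn P T := fun p hp q hq h => by rw [← hN p hp, ← hN q hq, h]
  have hpos : ∀ p ∈ T, (0 : ℝ) < p := fun p hp => by exact_mod_cast (hT p hp).1.pos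
  rw [← Finset.card_image_of_injOn hinj]
  let r : Ideal (𝓞 K) → ℝ := fun I => (Ideal.absNorm I : ℝ) ^ (1 / (n : ℝ))
  have hrn : ∀ I, r I ^ n = Ideal.absNorm I := fun I => by
    simp only [r]
    rw [one_div, Real.rpow_inv_natCast_pow (Nat.cast_nonneg _) hn0]
  have hrpos : ∀ p ∈ T, 0 < r (P p) := fun p hp => by
    simp only [r]
    rw [hN p hp]
    exact Real.rpow_pos_of_pos (hpos p hp) _
  refine card_torsion_mul_card_le hℓ (T.image P) ?_ hB hη hBn r ?_ (fun I _ => hrn I) ?_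
  · intro I hI h
    obtain ⟨p, hp, rfl⟩ := Finset.mem_image.1 hI
    have := hN p hp
    rw [h, Ideal.absNorm_bot] at this
    exact (hT p hp).1.ne_zero this.symm
  · intro I hI
    obtain ⟨p, hp, rfl⟩ := Finset.mem_image.1 hI
    exact hrpos p hp
  · intro I hI I' hI' hne J a b ha0 hb0 ha hb hv
    obtain ⟨p, hp, rfl⟩ := Finset.mem_image.1 hI
    obtain ⟨q, hq, rfl⟩ := Finset.mem_image.1 hI'
    have hpq : p ≠ q := fun h => hne (by rw [h])
    have hY : 0 ≤ Y := (hpos p hp).le.trans (hT p hp).2.1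
    have hry : ∀ p ∈ T, r (P p) ≤ Y ^ (1 / (n : ℝ)) := fun p hp => by
      simp only [r]
      rw [hN p hp]
      exact Real.rpow_le_rpow (Nat.cast_nonneg _) (hT p hp).2.1 (by positivity)
    have hcop : IsCoprime (P p) (P q) := by
      have h1 := isMaximal_of_mem_primesOver (hT p hp).1 (hPT p hp)
      have h2 := isMaximal_of_mem_primesOver (hT q hq).1 (hPT q hq)
      exact Ideal.isCoprime_of_isMaximal hne
    have hH := mulHeight₁_div_le ha0 ha hb hcop (hrpos p hp) (hrpos q hq)
      (Real.one_le_exp hη.le) (hry p hp) (hry q hq) (hrn _) hv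
    have htop := adjoin_div_eq_top hℓ (hT p hp).1 (hT q hq).1 hpq (hT p hp).2.2 (hPT p hp)
      (hPT q hq) hb0 ha hb
    rw [mul_pow, one_div, Real.rpow_inv_natCast_pow hY hn0] at hH
    refine absurd hH (not_le.2 (hgen _ fun F hF => ?_))
    have hle : ℚ⟮(a : K) / (b : K)⟯ ≤ F.toIntermediateField fun x => by
        rw [eq_ratCast]
        exact SubfieldClass.ratCast_mem F x := adjoin_simple_le_iff.2 hF
    rw [htop] at hle
    exact eq_top_iff.2 fun x _ => hle (mem_top (x := x))

end Generator

/-! ### Uniformity in the field -/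

section Uniform

/-- The bound for the `ℓ`-torsion in terms of degree and discriminant, with a constant that depends
only on the degree and the two exponents. -/
theorem exists_card_torsion_mul_card_le (d : ℕ) {κ σ : ℝ} (hκ : 0 < κ) (hσ : 0 < σ) :
    ∃ C : ℝ, 0 ≤ C ∧ ∀ (K : Type) [Field K] [NumberField K], finrank ℚ K = d → 1 < d →
      ∀ (ℓ : ℕ), ℓ ≠ 0 → ∀ (Y : ℝ) (T : Finset ℕ),
      (∀ p ∈ T, p.Prime ∧ (p : ℝ) ≤ Y ∧ ∀ P ∈ (Ideal.span {(p : ℤ)}).primesOver (𝓞 K),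
        P.ramificationIdx ℤ = 1 ∧ P.inertiaDeg ℤ = 1) →
      (∀ β : K, (∀ F : Subfield K, β ∈ F → F = ⊤) →
        (|(discr K : ℝ)| ^ κ * Y) ^ ℓ < Height.mulHeight₁ β) →
      (Nat.card {c : ClassGroup (𝓞 K) // c ^ ℓ = 1} : ℝ) * T.card ≤
        C * |(discr K : ℝ)| ^ (1 / 2 + σ) := by
  set s : ℝ := 1 + 2 * σ with hs
  refine ⟨((∑' m : ℕ, (m : ℝ) ^ (-s)) ^ d * ((2 : ℝ) ^ (d + 1)) ^ s) *
    ((d + 1) * (d + 2) / (κ / d) + 2) ^ d, ?_, ?_⟩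
  · have : 0 ≤ ∑' m : ℕ, (m : ℝ) ^ (-s) := tsum_nonneg fun _ => by positivity
    positivity
  intro K _ _ hd hd1 ℓ hℓ Y T hT hgen
  set D : ℝ := |(discr K : ℝ)|
  have hD : 2 < D := by
    have := abs_discr_gt_two (K := K) (by rw [hd]; exact hd1)
    change (2 : ℝ) < |(discr K : ℝ)|
    exact_mod_cast this
  have hd0 : (0 : ℝ) < d := by exact_mod_cast (by omega : 0 < d)
  have hlogD : 0 < Real.log D := Real.log_pos (by linarith)
  set B : ℝ := (2 ^ (d + 1) * √D) ^ (1 / (d : ℝ)) with hBdef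
  have hsqrt : 1 < √D := Real.lt_sqrt_of_sq_lt (by linarith)
  have hbase : 1 ≤ 2 ^ (d + 1) * √D :=
    one_le_mul_of_one_le_of_one_le (one_le_pow₀ (by norm_num)) hsqrt.le
  have hBd : B ^ d = 2 ^ (d + 1) * √D := by
    rw [hBdef, one_div, Real.rpow_inv_natCast_pow (by positivity) (by omega)]
  have hB : 1 ≤ B := Real.one_le_rpow hbase (by positivity)
  have hlogB : Real.log B ≤ (d + 2) * Real.log D := by
    have h1 : (d : ℝ) * Real.log B = (d + 1) * Real.log 2 + 1 / 2 * Real.log D := by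
      rw [← Real.log_pow, hBd, Real.log_mul (by positivity) (by positivity), Real.log_pow,
        Real.log_sqrt (by linarith)]
      push_cast
      ring
    have h2 : Real.log 2 ≤ Real.log D := Real.log_le_log (by norm_num) hD.le
    have h3 : (1 : ℝ) ≤ d := by exact_mod_cast hd1.le
    have h4 : 0 ≤ Real.log B := Real.log_nonneg hB
    have h5 : (d + 1 : ℝ) * Real.log 2 ≤ (d + 1) * Real.log D := by gcongr
    nlinarith
  set η : ℝ := κ / d * Real.log D with hηdef
  have hη : 0 < η := by positivity
  have hexp : Real.exp η ^ d = D ^ κ := by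
    rw [← Real.exp_nat_mul, hηdef, Real.rpow_def_of_pos (by linarith)]
    congr 1
    field_simp
  have key := card_torsion_mul_card_split_le (K := K) hℓ (Y := Y) T hT hB hη
    (by
      rw [hd, hBd, pow_succ]
      have : (0 : ℝ) < 2 ^ d * √D := by positivity
      linarith) (by rw [hd, hexp]; exact hgen)
  have hid := ncard_ideals_absNorm_le K (s := s) (by rw [hs]; linarith)
    (x := B ^ finrank ℚ K) (by positivity)
  refine key.trans ?_
  rw [hd] at hid ⊢
  have hbox : (d + 1) * Real.log B / η + 2 ≤ (d + 1) * (d + 2) / (κ / d) + 2 := by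
    rw [hηdef]
    have : (d + 1) * Real.log B / (κ / d * Real.log D) ≤
        (d + 1) * ((d + 2) * Real.log D) / (κ / d * Real.log D) := by gcongr
    refine (add_le_add_left this 2).trans_eq ?_
    field_simp
  have hsplit : (B ^ d) ^ s = ((2 : ℝ) ^ (d + 1)) ^ s * D ^ (1 / 2 + σ) := by
    rw [hBd, Real.mul_rpow (by positivity) (by positivity), Real.sqrt_eq_rpow,
      ← Real.rpow_mul (by positivity)]
    congr 2
    rw [hs]
    ring
  have hbox0 : 0 ≤ (d + 1) * Real.log B / η + 2 := by
    have := Real.log_nonneg hB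
    positivity
  rw [hsplit] at hid
  calc _ ≤ _ * _ := mul_le_mul hid (pow_le_pow_left₀ hbox0 hbox d) (by positivity)
        ((Nat.cast_nonneg _).trans hid)
    _ = _ := by ring

end Uniform

section Transfer

theorem absDiscr_eq (K : NField) : (absDiscr K : ℝ) = |(discr K.1 : ℝ)| := by
  rw [absDiscr, Nat.cast_natAbs, Int.cast_abs]

theorem finrank_of_mem_fieldsOfDegree {d : ℕ} {K : NField} (hK : K ∈ fieldsOfDegree d) :
    finrank ℚ K.1 = d :=
  hK

/-- That `β` generates `K` is expressed through subfields, which, unlike intermediate fields, do not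
refer to one of the two `ℚ`-algebra structures on `K.1`. -/
theorem adjoinField_eq_of_forall_subfield {K : NField} {β : K.1}
    (hβ : ∀ F : Subfield K.1, β ∈ F → F = ⊤) : adjoinField (β : AlgebraicClosure ℚ) = K := by
  refine Subtype.ext (le_antisymm (adjoin_simple_le_iff.2 β.2) fun x hx => ?_)
  have h := hβ (ℚ⟮(β : AlgebraicClosure ℚ)⟯.toSubfield.comap (algebraMap K.1 (AlgebraicClosure ℚ)))
    (mem_adjoin_simple_self ℚ _)
  have hx' : (⟨x, hx⟩ : K.1) ∈ (⊤ : Subfield K.1) := Subfield.mem_top _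
  rw [← h] at hx'
  exact hx'

theorem mulHeight₁_congr {K L : NField} (h : L = K) (x : L.1) (y : K.1)
    (hxy : (x : AlgebraicClosure ℚ) = y) :
    Height.mulHeight₁ x = Height.mulHeight₁ y := by
  subst h
  rw [Subtype.ext hxy]

theorem relHeight_coe {K : NField} {β : K.1} (hβ : adjoinField (β : AlgebraicClosure ℚ) = K) :
    relHeight (β : AlgebraicClosure ℚ) = Height.mulHeight₁ β :=
  mulHeight₁_congr hβ _ _ rfl

theorem finite_splitPrimes (K : NField) (Y : ℝ) : (splitPrimes K Y).Finite :=
  (Set.finite_Iic ⌊Y⌋₊).subset fun _ hp => Nat.le_floor hp.2.1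

/-- There are only finitely many fields of bounded discriminant, hence their class numbers are
bounded. -/
theorem exists_clTorsion_le (ℓ : ℕ) (N : ℝ) :
    ∃ H : ℝ, 0 ≤ H ∧ ∀ K : NField, (absDiscr K : ℝ) ≤ N → (clTorsion K ℓ : ℝ) ≤ H := by
  have hfin : {K : NField | (absDiscr K : ℝ) ≤ N}.Finite := by
    refine (finite_of_discr_bdd (AlgebraicClosure ℚ) ⌊N⌋₊).subset fun K hK => ?_
    have : absDiscr K ≤ ⌊N⌋₊ := Nat.le_floor hK
    have h : |discr K.1| ≤ ⌊N⌋₊ := by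
      rw [← Int.natCast_natAbs]
      exact_mod_cast this
    exact h
  obtain ⟨H, hH⟩ := (hfin.image fun K => (clTorsion K ℓ : ℝ)).bddAbove
  exact ⟨max H 0, le_max_right _ _, fun K hK => (hH ⟨K, hK, rfl⟩).trans (le_max_left _ _)⟩

end Transfer

/-! ### The exceptional fields -/

section Exceptional

/-- The fields in `S` generated by an element of small height. -/
theorem cardLE_fields_of_generator {S : Set NField} {θ C : ℝ}
    (hS : ∀ X : ℝ, 2 ≤ X → CardLE (generatorsOfHeightLE S X) (C * X ^ θ)) {Z : ℝ} (hZ : 1 ≤ Z) :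
    CardLE {K : NField | K ∈ S ∧ ∃ α, adjoinField α = K ∧ relHeight α ≤ Z}
      (|C| * 2 ^ θ * Z ^ θ) := by
  obtain ⟨hfin, hcard⟩ := hS (2 * Z) (by linarith)
  have hsub : {K : NField | K ∈ S ∧ ∃ α, adjoinField α = K ∧ relHeight α ≤ Z} ⊆
      adjoinField '' generatorsOfHeightLE S (2 * Z) := by
    rintro K ⟨hK, α, rfl, hα⟩
    exact ⟨α, ⟨hK, by linarith⟩, rfl⟩
  refine ⟨(hfin.image _).subset hsub, ?_⟩
  calc _ ≤ ((generatorsOfHeightLE S (2 * Z)).ncard : ℝ) := by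
        exact_mod_cast (Set.ncard_le_ncard hsub (hfin.image _)).trans (Set.ncard_image_le hfin)
    _ ≤ C * (2 * Z) ^ θ := hcard
    _ ≤ |C| * (2 * Z) ^ θ := by gcongr; exact le_abs_self C
    _ = _ := by rw [Real.mul_rpow (by norm_num) (by linarith), mul_assoc]

/-- The dyadic scales `X / 2 ^ k ≥ 2` are at most `2 log X` in number. -/
theorem cardLE_iUnion_dyadic {A : ℝ → Set NField} {E : ℝ → ℝ} (hE : MonotoneOn E (Set.Ici 2))
    (hA : ∀ X : ℝ, 2 ≤ X → CardLE (A X) (E X)) {X : ℝ} (hX : 2 ≤ X) :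
    CardLE {K : NField | ∃ k : ℕ, 2 ≤ X / 2 ^ k ∧ K ∈ A (X / 2 ^ k)} (2 * (Real.log X * E X)) := by
  set m := ⌊Real.log X / Real.log 2⌋₊
  have hlog2 : 0 < Real.log 2 := Real.log_pos (by norm_num)
  have hlogX : 0 ≤ Real.log X := Real.log_nonneg (by linarith)
  have hkm : ∀ k : ℕ, 2 ≤ X / 2 ^ k → k < m := by
    intro k hk
    rw [le_div_iff₀ (by positivity), ← pow_succ'] at hk
    refine Nat.lt_of_succ_le (Nat.le_floor ?_)
    rw [le_div_iff₀ hlog2, ← Real.log_pow]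
    exact Real.log_le_log (by positivity) hk
  have hscale : ∀ k < m, 2 ≤ X / 2 ^ k := by
    intro k hk
    have h1 : ((k + 1 : ℕ) : ℝ) ≤ Real.log X / Real.log 2 :=
      (Nat.cast_le.2 hk).trans (Nat.floor_le (by positivity))
    rw [le_div_iff₀ hlog2, ← Real.log_pow, Real.log_le_log_iff (by positivity) (by linarith)] at h1
    rwa [le_div_iff₀ (by positivity), ← pow_succ']
  have hsub : {K : NField | ∃ k : ℕ, 2 ≤ X / 2 ^ k ∧ K ∈ A (X / 2 ^ k)} ⊆
      ⋃ k ∈ Finset.range m, A (X / 2 ^ k) := by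
    rintro K ⟨k, hk, hK⟩
    exact Set.mem_biUnion (Finset.mem_range.2 (hkm k hk)) hK
  have hfin : (⋃ k ∈ Finset.range m, A (X / 2 ^ k)).Finite :=
    (Finset.range m).finite_toSet.biUnion fun k hk =>
      (hA _ (hscale k (Finset.mem_range.1 hk))).1
  have hE0 : 0 ≤ E X := (Nat.cast_nonneg _).trans (hA X hX).2
  refine ⟨hfin.subset hsub, ?_⟩
  calc _ ≤ ((⋃ k ∈ Finset.range m, A (X / 2 ^ k)).ncard : ℝ) := by
        exact_mod_cast Set.ncard_le_ncard hsub hfin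
    _ ≤ ∑ k ∈ Finset.range m, ((A (X / 2 ^ k)).ncard : ℝ) := by
        exact_mod_cast Finset.set_ncard_biUnion_le _ _
    _ ≤ ∑ k ∈ Finset.range m, E X := by
        refine Finset.sum_le_sum fun k hk => ?_
        have h2 := hscale k (Finset.mem_range.1 hk)
        exact (hA _ h2).2.trans (hE h2 hX (div_le_self (by linarith) (one_le_pow₀ (by norm_num))))
    _ = m * E X := by simp
    _ ≤ Real.log X / Real.log 2 * E X := by
        gcongr
        exact Nat.floor_le (by positivity)
    _ ≤ 2 * Real.log X * E X := by
        gcongr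
        rw [div_le_iff₀ hlog2]
        nlinarith [Real.log_two_gt_d9]
    _ = _ := by ring

/-- Away from fields with a generator of small height and from fields with few split primes at the
scale `Z` of their discriminant, the `ℓ`-torsion is small. -/
theorem exists_clTorsion_le_rpow (d : ℕ) (hd : 1 < d) (ℓ : ℕ) (hℓ : 1 ≤ ℓ) {γ ε : ℝ} (hγ : 0 < γ)
    (hε : 0 < ε) : ∃ C : ℝ, ∀ δ : ℝ, δ ≤ γ / ℓ - 2 * ε → ∀ S ⊆ fieldsOfDegree d, ∀ K ∈ S,
      ∀ Z : ℝ, (absDiscr K : ℝ) ≤ Z → Z ≤ 2 * absDiscr K →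
      K ∉ badFields S Z (Z ^ δ) (Z ^ (δ - ε)) →
      (¬ ∃ α, adjoinField α = K ∧ relHeight α ≤ (absDiscr K : ℝ) ^ γ) →
      (clTorsion K ℓ : ℝ) ≤ C * (absDiscr K : ℝ) ^ (1 / 2 - δ + 2 * ε) := by
  obtain ⟨C, hC0, hC⟩ := exists_card_torsion_mul_card_le d hε hε
  -- Above this bound the factor `2 ^ γ` lost in passing from `D_K` to `Z` is absorbed.
  set N : ℝ := 2 ^ (γ / ε) with hN
  have hN1 : 1 ≤ N := Real.one_le_rpow (by norm_num) (by positivity)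
  obtain ⟨H, hH0, hH⟩ := exists_clTorsion_le ℓ N
  refine ⟨max (H * N ^ γ) (C * 2 ^ ε), fun δ hδ S hS K hK Z hDZ hZD hbad hgen => ?_⟩
  have hℓ1 : (1 : ℝ) ≤ ℓ := by exact_mod_cast hℓ
  have hdeg : finrank ℚ K.1 = d := finrank_of_mem_fieldsOfDegree (hS hK)
  set D : ℝ := (absDiscr K : ℝ) with hDdef
  have hD : 2 < D := by
    rw [hDdef, absDiscr_eq]
    exact_mod_cast abs_discr_gt_two (K := K.1) (by rw [hdeg]; exact hd)
  have hZ : 2 < Z := hD.trans_le hDZ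
  by_cases hDN : D ≤ N
  · have h1 : δ ≤ γ := by
      have : γ / ℓ ≤ γ := div_le_self hγ.le hℓ1
      linarith
    calc (clTorsion K ℓ : ℝ) ≤ H := hH K hDN
      _ = H * N ^ γ * N ^ (-γ) := by
          rw [mul_assoc, ← Real.rpow_add (by linarith), add_neg_cancel, Real.rpow_zero, mul_one]
      _ ≤ H * N ^ γ * D ^ (-γ) := by
          refine mul_le_mul_of_nonneg_left ?_ (by positivity)
          exact Real.rpow_le_rpow_of_nonpos (by linarith) hDN (by linarith)
      _ ≤ max (H * N ^ γ) (C * 2 ^ ε) * D ^ (1 / 2 - δ + 2 * ε) := by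
          refine mul_le_mul (le_max_left _ _) ?_ (by positivity) (by positivity)
          exact Real.rpow_le_rpow_of_exponent_le (by linarith) (by linarith)
  push Not at hDN
  have hmany : Z ^ (δ - ε) < (splitPrimes K (Z ^ δ)).ncard := by
    by_contra! h
    exact hbad ⟨hK, hDZ, h⟩
  have hδ0 : 0 < δ := by
    by_contra! h
    have : splitPrimes K (Z ^ δ) = ∅ := by
      rw [Set.eq_empty_iff_forall_notMem]
      rintro p ⟨hp, hpZ, -⟩
      have h1 : Z ^ δ ≤ 1 := Real.rpow_le_one_of_one_le_of_nonpos (by linarith) h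
      have h2 : (2 : ℝ) ≤ p := by exact_mod_cast hp.two_le
      linarith
    rw [this, Set.ncard_empty, Nat.cast_zero] at hmany
    exact absurd hmany (not_lt.2 (by positivity))
  have hfin := finite_splitPrimes K (Z ^ δ)
  have hheight : (D ^ ε * Z ^ δ) ^ ℓ ≤ D ^ γ := by
    have hδℓ : δ * ℓ ≤ γ - 2 * ε * ℓ := by
      have := mul_le_mul_of_nonneg_right hδ (by linarith : (0 : ℝ) ≤ ℓ)
      rw [sub_mul, div_mul_cancel₀ _ (by linarith)] at this
      exact this
    have h2D : (2 : ℝ) ^ γ ≤ D ^ ε := by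
      have := Real.rpow_le_rpow (by linarith) hDN.le hε.le
      rwa [hN, ← Real.rpow_mul (by norm_num), div_mul_cancel₀ _ hε.ne'] at this
    calc (D ^ ε * Z ^ δ) ^ ℓ ≤ (D ^ ε * (2 * D) ^ δ) ^ ℓ := by
          gcongr
      _ = D ^ (ε * ℓ) * (2 ^ (δ * ℓ) * D ^ (δ * ℓ)) := by
          rw [Real.mul_rpow (by norm_num) (by linarith), mul_pow, mul_pow,
            ← Real.rpow_mul_natCast (by linarith),
            ← Real.rpow_mul_natCast (by norm_num), ← Real.rpow_mul_natCast (by linarith)]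
      _ ≤ D ^ (ε * ℓ) * (D ^ (ε * ℓ) * D ^ (γ - 2 * ε * ℓ)) := by
          gcongr
          · calc (2 : ℝ) ^ (δ * ℓ) ≤ 2 ^ γ := Real.rpow_le_rpow_of_exponent_le (by norm_num) (by
                  have : 0 ≤ 2 * ε * ℓ := by positivity
                  linarith)
              _ ≤ D ^ ε := h2D
              _ ≤ D ^ (ε * ℓ) := Real.rpow_le_rpow_of_exponent_le (by linarith) (by nlinarith)
          · linarith
      _ = D ^ γ := by
          rw [← Real.rpow_add (by linarith), ← Real.rpow_add (by linarith)]
          congr 1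
          ring
  have hmain := hC K.1 hdeg hd ℓ (by omega) (Z ^ δ) hfin.toFinset
    (fun p hp => by
      have hp' : p ∈ splitPrimes K (Z ^ δ) := by simpa using hp
      exact hp')
    (fun β hβ => by
      have hfield := adjoinField_eq_of_forall_subfield hβ
      by_contra! hle
      rw [← absDiscr_eq] at hle
      exact hgen ⟨β, hfield, (relHeight_coe hfield).trans_le (hle.trans hheight)⟩)
  rw [← absDiscr_eq, ← Set.ncard_eq_toFinset_card _ hfin] at hmain
  have hlow : 2 ^ (-ε) * D ^ (δ - ε) ≤ Z ^ (δ - ε) := by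
    rcases le_total 0 (δ - ε) with h | h
    · calc (2 : ℝ) ^ (-ε) * D ^ (δ - ε) ≤ 1 * Z ^ (δ - ε) := by
            gcongr
            exact Real.rpow_le_one_of_one_le_of_nonpos (by norm_num) (by linarith)
        _ = _ := one_mul _
    · calc (2 : ℝ) ^ (-ε) * D ^ (δ - ε) ≤ 2 ^ (δ - ε) * D ^ (δ - ε) := by
            gcongr
            · norm_num
            · linarith
        _ = (2 * D) ^ (δ - ε) := (Real.mul_rpow (by norm_num) (by linarith)).symm
        _ ≤ Z ^ (δ - ε) := Real.rpow_le_rpow_of_nonpos (by linarith) hZD h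
  have hpos : 0 < 2 ^ (-ε) * D ^ (δ - ε) := by positivity
  have h1 : (clTorsion K ℓ : ℝ) * (2 ^ (-ε) * D ^ (δ - ε)) ≤ C * D ^ (1 / 2 + ε) :=
    (mul_le_mul_of_nonneg_left (hlow.trans hmany.le) (Nat.cast_nonneg _)).trans hmain
  rw [← le_div_iff₀ hpos] at h1
  calc (clTorsion K ℓ : ℝ) ≤ C * D ^ (1 / 2 + ε) / (2 ^ (-ε) * D ^ (δ - ε)) := h1
    _ = C * 2 ^ ε * D ^ (1 / 2 - δ + 2 * ε) := by
        rw [Real.rpow_neg (by norm_num),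
          show 1 / 2 - δ + 2 * ε = (1 / 2 + ε) - (δ - ε) by ring,
          Real.rpow_sub (by linarith) (1 / 2 + ε) (δ - ε)]
        field_simp
    _ ≤ _ := by
        gcongr
        exact le_max_right _ _

end Exceptional

end ClassGroupTorsion

theorem proposition3p1 (d : ℕ) (hd : 1 < d) :
    -- `C₁ ℓ γ ε` is the constant in the bound for the torsion; it depends on `d, ℓ, γ, ε` only
    ∃ C₁ : ℕ → ℝ → ℝ → ℝ,
      ∀ S : Set ClassGroupTorsion.NField, S ⊆ ClassGroupTorsion.fieldsOfDegree d →
      ∀ θ : ℝ, 0 < θ →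
      (∃ C : ℝ, ∀ X : ℝ, 2 ≤ X →
        ClassGroupTorsion.CardLE (ClassGroupTorsion.generatorsOfHeightLE S X) (C * X ^ θ)) →
      -- `C₂` is the constant in the bound for the exceptional set; it depends on `S, θ` only
      ∃ C₂ : ℝ,
        ∀ ℓ : ℕ, 1 ≤ ℓ →
        ∀ γ ε δ' δ₀ : ℝ, 0 < γ → 0 < ε → 0 < δ' → δ₀ = min (γ / (ℓ : ℝ) - 2 * ε) δ' →
        ∀ E : ℝ → ℝ, MonotoneOn E (Set.Ici 2) →
        (∀ X : ℝ, 2 ≤ X →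
          ClassGroupTorsion.CardLE
            (ClassGroupTorsion.badFields S X (X ^ δ₀) (X ^ (δ₀ - ε))) (E X)) →
        ∀ X : ℝ, 2 ≤ X →
          ClassGroupTorsion.CardLE
            {K : ClassGroupTorsion.NField | K ∈ S ∧ (ClassGroupTorsion.absDiscr K : ℝ) ≤ X ∧
              ¬ ((ClassGroupTorsion.clTorsion K ℓ : ℝ) ≤
                C₁ ℓ γ ε * (ClassGroupTorsion.absDiscr K : ℝ) ^ (1 / 2 - δ₀ + 2 * ε))}
            (C₂ * (Real.log X * E X + X ^ (γ * θ))) := by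
  open ClassGroupTorsion in
  have hconst : ∀ (ℓ : ℕ) (γ ε : ℝ), ∃ C : ℝ, 1 ≤ ℓ → 0 < γ → 0 < ε →
      ∀ δ : ℝ, δ ≤ γ / ℓ - 2 * ε → ∀ S ⊆ fieldsOfDegree d, ∀ K ∈ S,
      ∀ Z : ℝ, (absDiscr K : ℝ) ≤ Z → Z ≤ 2 * absDiscr K →
      K ∉ badFields S Z (Z ^ δ) (Z ^ (δ - ε)) →
      (¬ ∃ α, adjoinField α = K ∧ relHeight α ≤ (absDiscr K : ℝ) ^ γ) →
      (clTorsion K ℓ : ℝ) ≤ C * (absDiscr K : ℝ) ^ (1 / 2 - δ + 2 * ε) := by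
    intro ℓ γ ε
    by_cases h : 1 ≤ ℓ ∧ 0 < γ ∧ 0 < ε
    · obtain ⟨C, hC⟩ := exists_clTorsion_le_rpow d hd ℓ h.1 h.2.1 h.2.2
      exact ⟨C, fun _ _ _ => hC⟩
    · exact ⟨0, fun h1 h2 h3 => absurd ⟨h1, h2, h3⟩ h⟩
  choose C₁ hC₁ using hconst
  refine ⟨C₁, fun S hS θ hθ ⟨C, hC⟩ => ⟨2 + |C| * 2 ^ θ, fun ℓ hℓ γ ε δ' δ₀ hγ hε _ hδ₀ E hE hbad
    X hX => ?_⟩⟩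
  have hδ : δ₀ ≤ γ / ℓ - 2 * ε := hδ₀ ▸ min_le_left _ _
  obtain ⟨hfin1, hcard1⟩ := cardLE_iUnion_dyadic hE hbad hX
  obtain ⟨hfin2, hcard2⟩ := cardLE_fields_of_generator hC (Z := X ^ γ)
    (Real.one_le_rpow (by linarith) hγ.le)
  have hsub : {K : NField | K ∈ S ∧ (absDiscr K : ℝ) ≤ X ∧
      ¬ ((clTorsion K ℓ : ℝ) ≤ C₁ ℓ γ ε * (absDiscr K : ℝ) ^ (1 / 2 - δ₀ + 2 * ε))} ⊆
      {K : NField | ∃ k : ℕ, 2 ≤ X / 2 ^ k ∧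
        K ∈ badFields S (X / 2 ^ k) ((X / 2 ^ k) ^ δ₀) ((X / 2 ^ k) ^ (δ₀ - ε))} ∪
      {K : NField | K ∈ S ∧ ∃ α, adjoinField α = K ∧ relHeight α ≤ X ^ γ} := by
    rintro K ⟨hK, hKX, hK'⟩
    by_contra hnot
    rw [Set.mem_union, not_or] at hnot
    obtain ⟨hnot1, hnot2⟩ := hnot
    have hdeg : Module.finrank ℚ K.1 = d :=
      finrank_of_mem_fieldsOfDegree (hS hK)
    have hD : (2 : ℝ) < absDiscr K := by
      rw [absDiscr_eq]
      exact_mod_cast NumberField.abs_discr_gt_two (K := K.1) (by rw [hdeg]; exact hd)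
    obtain ⟨k, hk1, hk2⟩ := exists_nat_pow_near ((one_le_div (by linarith)).2 hKX)
      (by norm_num : (1 : ℝ) < 2)
    rw [le_div_iff₀ (by linarith), mul_comm, ← le_div_iff₀ (by positivity)] at hk1
    rw [div_lt_iff₀ (by linarith), pow_succ, mul_assoc, mul_comm,
      ← div_lt_iff₀ (by positivity)] at hk2
    refine hK' (hC₁ ℓ γ ε hℓ hγ hε δ₀ hδ S hS K hK (X / 2 ^ k) hk1 hk2.le
      (fun h => hnot1 ⟨k, by linarith, h⟩) ?_)
    rintro ⟨α, hα, hαD⟩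
    exact hnot2 ⟨hK, α, hα, hαD.trans (Real.rpow_le_rpow (by linarith) hKX hγ.le)⟩
  refine ⟨(hfin1.union hfin2).subset hsub, ?_⟩
  have hle : 0 ≤ Real.log X * E X := mul_nonneg (Real.log_nonneg (by linarith))
    ((Nat.cast_nonneg _).trans (hbad X hX).2)
  have hX0 : 0 ≤ X ^ (γ * θ) := by positivity
  have hC0 : 0 ≤ |C| * 2 ^ θ := by positivity
  rw [← Real.rpow_mul (by linarith)] at hcard2
  refine (show _ ≤ ((_ + _ : ℕ) : ℝ) by
    exact_mod_cast (Set.ncard_le_ncard hsub (hfin1.union hfin2)).trans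
      (Set.ncard_union_le _ _)).trans ?_
  push_cast
  nlinarith
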